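/- Let $\mathscr{A}$ be a finite set with the discrete topology, let $\mathscr{A}^\infty$ be the space of all sequences $x=(x_j)_{j\ge 0}$ in $\mathscr{A}$ with the product topology, and let $\sigma\colon\mathscr{A}^\infty\to\mathscr{A}^\infty$, $\sigma(x)_j=x_{j+1}$, be the shift. A shift space over $\mathscr{A}$ is a nonempty closed set $X\subseteq\mathscr{A}^\infty$ with $\sigma(X)\subseteq X$. Let $\mathcal{M}_\sigma(X)$ be the set of all $\sigma$-invariant Borel probability measures $\mu$ on $\mathscr{A}^\infty$ with $\mu(X)=1$, and let $\mathcal{M}^e_\sigma(X)$ be the set of all ergodic measures in $\mathcal{M}_\sigma(X)$. For $x,y\in\mathscr{A}^\infty$ put \[ \bar d(x,y)=\limsup_{n\to\infty}\frac1n\bigl|\{0\le j<n: x_j\ne y_j\}\bigr|,\qquad \underline d(x,y)=\liminf_{n\to\infty}\frac1n\bigl|\{0\le j<n: x_j\ne y_j\}\bigr|. \] For $\sigma$-invariant Borel probability measures $\mu,\nu$ on $\mathscr{A}^\infty$ put \[ \bar d_{\mathcal{M}}(\mu,\nu)=\inf_{\lambda\in J(\mu,\nu)}\lambda\bigl(\{(x,y)\in\mathscr{A}^\infty\times\mathscr{A}^\infty: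 x_0\ne y_0\}\bigr), \] where $J(\mu,\nu)$ is the set of joinings of $\mu$ and $\nu$, that is, of $\sigma\times\sigma$-invariant Borel measures on $\mathscr{A}^\infty\times\mathscr{A}^\infty$ with first marginal $\mu$ and second marginal $\nu$. For a symmetric function $\rho\colon Z\times Z\to[0,1]$ that vanishes on the diagonal and nonempty $S,T\subseteq Z$ put \[ \rho^H(S,T)=\max\Bigl\{\sup_{a\in S}\inf_{b\in T}\rho(a,b),\ \sup_{b\in T}\inf_{a\in S}\rho(b,a)\Bigr\}. \] If $X$ and $Y$ are shift spaces over $\mathscr{A}$, then \[ \bar d_{\mathcal{M}}^H(\mathcal{M}_\sigma(X),\mathcal{M}_\sigma(Y))=\bar d_{\mathcal{M}}^H(\mathcal{M}^e_\sigma(X),\mathcal{M}^e_\sigma(Y))\le\underline d^H(X,Y)\le\bar d^H(X,Y). \] -/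

import Mathlib

open MeasureTheory Filter
open scoped ENNReal

noncomputable section

namespace DBar

/-- The shift transformation on one-sided sequences, `(shiftMap x) j = x (j + 1)`: Mathlib's
left-translation shift by `1` on configurations over the additive monoid of natural numbers. -/
def shiftMap {A : Type*} : (ℕ → A) → (ℕ → A) :=
  SymbolicDynamics.FullShift.shift (1 : ℕ)

theorem shiftMap_apply {A : Type*} (x : ℕ → A) (j : ℕ) : shiftMap x j = x (j + 1) := by
  simp [shiftMap, Nat.add_comm]

/-- The number of indices `0 ≤ j < n` with `x j ≠ y j`. -/
def mismatchCount {A : Type*} (n : ℕ) (x y : ℕ → A) : ℕ :=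
  {j : ℕ | j < n ∧ x j ≠ y j}.ncard

/-- The pointwise d-bar pseudometric: upper density of the set of disagreements. -/
def dUpper {A : Type*} (x y : ℕ → A) : ℝ≥0∞ :=
  limsup (fun n : ℕ => (mismatchCount n x y : ℝ≥0∞) / (n : ℝ≥0∞)) atTop

/-- The pointwise lower d-bar premetric: lower density of the set of disagreements. -/
def dLower {A : Type*} (x y : ℕ → A) : ℝ≥0∞ :=
  liminf (fun n : ℕ => (mismatchCount n x y : ℝ≥0∞) / (n : ℝ≥0∞)) atTop

open Classical in
/-- `dZero x y` is `1` if `x 0 ≠ y 0`, and `0` otherwise. -/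
def dZero {A : Type*} (x y : ℕ → A) : ℝ≥0∞ :=
  if x 0 ≠ y 0 then 1 else 0

/-- `lam` is a joining of `μ` and `ν`: it is invariant under the product of the shift with itself,
and its marginals are `μ` and `ν`. -/
structure IsJoining {A : Type*} [MeasurableSpace A] (μ ν : ProbabilityMeasure (ℕ → A))
    (lam : Measure ((ℕ → A) × (ℕ → A))) : Prop where
  invariant : MeasurePreserving (Prod.map shiftMap shiftMap) lam lam
  map_fst : lam.map Prod.fst = (μ : Measure (ℕ → A))
  map_snd : lam.map Prod.snd = (ν : Measure (ℕ → A))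

/-- Ornstein's d-bar distance: the infimum over all joinings `lam` of `μ` and `ν` of the
integral of `dZero` with respect to `lam`. -/
def dMeas {A : Type*} [MeasurableSpace A] (μ ν : ProbabilityMeasure (ℕ → A)) : ℝ≥0∞ :=
  ⨅ (lam : Measure ((ℕ → A) × (ℕ → A))) (_ : IsJoining μ ν lam), ∫⁻ p, dZero p.1 p.2 ∂lam

/-- The Hausdorff premetric induced by a (not necessarily triangular) distance function `ρ`:
the larger of `sup_{a ∈ S} inf_{b ∈ T} ρ a b` and `sup_{b ∈ T} inf_{a ∈ S} ρ b a`. -/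
def hausdorffPremetric {Z : Type*} (ρ : Z → Z → ℝ≥0∞) (S T : Set Z) : ℝ≥0∞ :=
  max (⨆ a ∈ S, ⨅ b ∈ T, ρ a b) (⨆ b ∈ T, ⨅ a ∈ S, ρ b a)

/-- The shift-invariant Borel probability measures supported on `X`. -/
def invariantMeasures {A : Type*} [MeasurableSpace A] (X : Set (ℕ → A)) :
    Set (ProbabilityMeasure (ℕ → A)) :=
  {μ | MeasurePreserving shiftMap (μ : Measure (ℕ → A)) (μ : Measure (ℕ → A)) ∧
    (μ : Measure (ℕ → A)) X = 1}

/-- The ergodic shift-invariant Borel probability measures supported on `X`. -/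
def ergodicMeasures {A : Type*} [MeasurableSpace A] (X : Set (ℕ → A)) :
    Set (ProbabilityMeasure (ℕ → A)) :=
  {μ | μ ∈ invariantMeasures X ∧ Ergodic shiftMap (μ : Measure (ℕ → A))}

/-- A shift space over `A`: a nonempty, closed, (forward) shift-invariant set of one-sided
sequences, i.e. the carrier of one of Mathlib's subshifts over `ℕ` that is nonempty. -/
def IsShiftSpace {A : Type*} [TopologicalSpace A] (X : Set (ℕ → A)) : Prop :=
  X.Nonempty ∧ ∃ S : SymbolicDynamics.FullShift.Subshift A ℕ, S.carrier = X

/-- It is enough to check invariance under the shift by one. -/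
theorem isShiftSpace_iff {A : Type*} [TopologicalSpace A] (X : Set (ℕ → A)) :
    IsShiftSpace X ↔ X.Nonempty ∧ IsClosed X ∧ Set.MapsTo shiftMap X X := by
  constructor
  · rintro ⟨hne, S, rfl⟩
    exact ⟨hne, S.isClosed, S.mapsTo 1⟩
  · rintro ⟨hne, hc, hm⟩
    refine ⟨hne, ⟨X, hc, fun g => ?_⟩, rfl⟩
    induction g with
    | zero => intro x hx; simpa using hx
    | succ g ih =>
      intro x hx
      rw [SymbolicDynamics.FullShift.shift_add]
      exact hm (ih hx)

end DBar

end

/-! Joinings with second marginal on `Y` form a weak-* compact convex set of probability measures.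
The cost of a joining is its mass on the clopen set `zeroNe A`, so it is continuous and affine.

If `μ` is ergodic, it is extreme among the invariant measures. The cost minimizers among joinings of
`μ` with measures on `Y` therefore form a closed face of the invariant measures on the product. By
Krein-Milman this face contains an ergodic joining, whose second marginal is an ergodic measure on
`Y` (`exists_ergodic_dMeas_le`). Hence restricting both sides to ergodic measures does not increase
the one-sided distance. Conversely, the first marginals of joinings of cost at most `r` form a
closed convex set; if it contains the ergodic measures on `X`, it contains all invariant ones.

For the pointwise bound, Birkhoff's theorem supplies a point `x` of `X` generic for the ergodic `μ`.
If `y` in `Y` satisfies `dLower x y < r`, then along suitable times the empirical measures of `(x,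
y)` accumulate at a joining of `μ` with a measure on `Y` of cost at most `r`
(`exists_joining_of_dLower_lt`), and the second marginal is again made ergodic. -/

namespace DBar

/-! ### Birkhoff's theorem via the maximal ergodic inequality. -/

section Birkhoff

open Topology

variable {Z : Type*}

/-- The running maximum `max (0, S₁ g, …, Sₙ g)` of the Birkhoff sums of `g`. -/
def maxBirkhoffSum (T : Z → Z) (g : Z → ℝ) : ℕ → Z → ℝ
  | 0 => fun _ => 0
  | n + 1 => fun x => max 0 (g x + maxBirkhoffSum T g n (T x))

theorem maxBirkhoffSum_nonneg (T : Z → Z) (g : Z → ℝ) (n : ℕ) (x : Z) :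
    0 ≤ maxBirkhoffSum T g n x := by
  cases n with
  | zero => exact le_rfl
  | succ n => exact le_max_left _ _

theorem maxBirkhoffSum_le_succ (T : Z → Z) (g : Z → ℝ) (n : ℕ) (x : Z) :
    maxBirkhoffSum T g n x ≤ maxBirkhoffSum T g (n + 1) x := by
  induction n generalizing x with
  | zero => exact le_max_left _ _
  | succ n ih => exact max_le_max le_rfl (by linarith [ih (T x)])

theorem birkhoffSum_le_maxBirkhoffSum (T : Z → Z) (g : Z → ℝ) (n : ℕ) (x : Z) :
    birkhoffSum T g n x ≤ maxBirkhoffSum T g n x := by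
  induction n generalizing x with
  | zero => simp [maxBirkhoffSum]
  | succ n ih =>
    rw [birkhoffSum_succ']
    exact le_max_of_le_right (by linarith [ih (T x)])

/-- Makes the set of points with bounded running maxima strictly invariant, so that ergodicity gives
it measure zero or full measure. -/
theorem bddAbove_maxBirkhoffSum_comp_iff (T : Z → Z) (g : Z → ℝ) (x : Z) :
    BddAbove (Set.range fun n => maxBirkhoffSum T g n (T x)) ↔
      BddAbove (Set.range fun n => maxBirkhoffSum T g n x) := by
  constructor
  · rintro ⟨C, hC⟩
    refine ⟨max 0 (g x + C), ?_⟩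
    rintro _ ⟨n, rfl⟩
    refine (maxBirkhoffSum_le_succ T g n x).trans (max_le_max le_rfl ?_)
    linarith [hC ⟨n, rfl⟩]
  · rintro ⟨C, hC⟩
    refine ⟨C - g x, ?_⟩
    rintro _ ⟨n, rfl⟩
    have h1 : maxBirkhoffSum T g (n + 1) x ≤ C := hC ⟨n + 1, rfl⟩
    have h2 : g x + maxBirkhoffSum T g n (T x) ≤ maxBirkhoffSum T g (n + 1) x := le_max_right _ _
    simp only
    linarith

variable [MeasurableSpace Z] {μ : Measure Z} {T : Z → Z} {g : Z → ℝ}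

theorem measurable_maxBirkhoffSum (hT : Measurable T) (hg : Measurable g) (n : ℕ) :
    Measurable (maxBirkhoffSum T g n) := by
  induction n with
  | zero => exact measurable_const
  | succ n ih => exact measurable_const.max (hg.add (ih.comp hT))

theorem integrable_maxBirkhoffSum (hT : MeasurePreserving T μ μ) (hg : Integrable g μ) (n : ℕ) :
    Integrable (maxBirkhoffSum T g n) μ := by
  induction n with
  | zero => exact integrable_zero _ _ _
  | succ n ih => exact (integrable_zero _ _ _).sup (hg.add (hT.integrable_comp_of_integrable ih))

/-- A form of the maximal ergodic theorem. -/
theorem integral_nonneg_of_ae_not_bddAbove (hT : MeasurePreserving T μ μ) (hg : Integrable g μ)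
    (h : ∀ᵐ x ∂μ, ¬ BddAbove (Set.range fun n => maxBirkhoffSum T g n x)) :
    0 ≤ ∫ x, g x ∂μ := by
  -- By the recursion, the integrand equals `g x` as soon as `maxBirkhoffSum T g n (T x)` exceeds
  -- `-g x`, and it is always bounded by `|g x|`. Its integral is nonnegative by invariance and
  -- monotonicity in `n`.
  have hlim : Tendsto (fun n => ∫ x, (maxBirkhoffSum T g (n + 1) x - maxBirkhoffSum T g n (T x)) ∂μ)
      atTop (𝓝 (∫ x, g x ∂μ)) := by
    refine tendsto_integral_of_dominated_convergence (fun x => |g x|) (fun n => ?_) hg.abs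
      (fun n => ?_) ?_
    · exact ((integrable_maxBirkhoffSum hT hg _).sub
        (hT.integrable_comp_of_integrable (integrable_maxBirkhoffSum hT hg n))).aestronglyMeasurable
    · refine ae_of_all _ fun x => ?_
      have := maxBirkhoffSum_nonneg T g n (T x)
      simp only [maxBirkhoffSum, Real.norm_eq_abs]
      rcases max_cases 0 (g x + maxBirkhoffSum T g n (T x)) with ⟨h1, h2⟩ | ⟨h1, h2⟩
      · rw [h1, abs_le]
        constructor <;> cases abs_cases (g x) <;> linarith
      · rw [h1, add_sub_cancel_right]
    · filter_upwards [h] with x hx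
      rw [← bddAbove_maxBirkhoffSum_comp_iff] at hx
      obtain ⟨N, hN⟩ : ∃ N, -g x < maxBirkhoffSum T g N (T x) := by
        by_contra! hcon
        exact hx ⟨-g x, by rintro _ ⟨n, rfl⟩; exact hcon n⟩
      refine tendsto_const_nhds.congr' ?_
      filter_upwards [eventually_ge_atTop N] with n hn
      have := monotone_nat_of_le_succ (fun n => maxBirkhoffSum_le_succ T g n (T x)) hn
      simp only [maxBirkhoffSum]
      rw [max_eq_right (by linarith), add_sub_cancel_right]
  refine ge_of_tendsto' hlim fun n => ?_
  have hint : Integrable (fun x => maxBirkhoffSum T g n (T x)) μ :=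
    hT.integrable_comp_of_integrable (integrable_maxBirkhoffSum hT hg n)
  rw [integral_sub (integrable_maxBirkhoffSum hT hg _) hint]
  have h1 : ∫ x, maxBirkhoffSum T g n (T x) ∂μ = ∫ x, maxBirkhoffSum T g n x ∂μ := by
    conv_rhs => rw [← hT.map_eq]
    rw [integral_map hT.measurable.aemeasurable]
    rw [hT.map_eq]
    exact (integrable_maxBirkhoffSum hT hg n).aestronglyMeasurable
  rw [h1, sub_nonneg]
  exact integral_mono (integrable_maxBirkhoffSum hT hg _) (integrable_maxBirkhoffSum hT hg _)
    (maxBirkhoffSum_le_succ T g n)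

theorem ae_bddAbove_maxBirkhoffSum (hT : Ergodic T μ) (hgm : Measurable g) (hg : Integrable g μ)
    (h : ∫ x, g x ∂μ < 0) :
    ∀ᵐ x ∂μ, BddAbove (Set.range fun n => maxBirkhoffSum T g n x) := by
  have hm : MeasurableSet {x | BddAbove (Set.range fun n => maxBirkhoffSum T g n x)} :=
    measurableSet_bddAbove_range (measurable_maxBirkhoffSum hT.measurable hgm)
  rcases hT.toPreErgodic.ae_mem_or_ae_notMem hm
    (Set.ext fun x => bddAbove_maxBirkhoffSum_comp_iff T g x) with h1 | h1
  · exact h1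
  · exact absurd (integral_nonneg_of_ae_not_bddAbove hT.toMeasurePreserving hg h1) (not_le.2 h)

theorem ae_eventually_birkhoffAverage_lt [IsProbabilityMeasure μ] (hT : Ergodic T μ)
    (hgm : Measurable g) (hg : Integrable g μ) {ε : ℝ} (hε : 0 < ε) :
    ∀ᵐ x ∂μ, ∀ᶠ n in atTop, birkhoffAverage ℝ T g n x < ∫ x, g x ∂μ + ε := by
  -- Half of `ε` makes the integral of `g - c` negative, so its Birkhoff sums are bounded above by
  -- some `C`; the other half absorbs `C / n`.
  set c := ∫ x, g x ∂μ + ε / 2 with hc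
  have h := ae_bddAbove_maxBirkhoffSum (g := fun x => g x - c) hT (hgm.sub_const c)
    (hg.sub (integrable_const c)) (by
      rw [integral_sub hg (integrable_const c)]
      simp only [integral_const, probReal_univ, one_smul]
      linarith)
  filter_upwards [h] with x ⟨C, hC⟩
  have h0 : Tendsto (fun n : ℕ => C / (n : ℝ)) atTop (𝓝 0) := tendsto_const_div_atTop_nhds_zero_nat C
  filter_upwards [h0.eventually_lt_const (half_pos hε), eventually_gt_atTop 0] with n hn hn0
  have hn0' : (0 : ℝ) < n := by exact_mod_cast hn0
  have h1 : birkhoffSum T (fun x => g x - c) n x ≤ C :=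
    (birkhoffSum_le_maxBirkhoffSum T _ n x).trans (hC ⟨n, rfl⟩)
  have h2 : birkhoffSum T (fun x => g x - c) n x = birkhoffSum T g n x - n * c := by
    simp [birkhoffSum, Finset.sum_sub_distrib]
  rw [h2] at h1
  rw [div_lt_iff₀ hn0'] at hn
  rw [birkhoffAverage, smul_eq_mul, inv_mul_lt_iff₀ hn0']
  rw [hc] at h1
  nlinarith

/-- Birkhoff's pointwise ergodic theorem for ergodic transformations. -/
theorem ae_tendsto_birkhoffAverage [IsProbabilityMeasure μ] (hT : Ergodic T μ)
    (hgm : Measurable g) (hg : Integrable g μ) :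
    ∀ᵐ x ∂μ, Tendsto (fun n => birkhoffAverage ℝ T g n x) atTop (𝓝 (∫ x, g x ∂μ)) := by
  have h1 : ∀ᵐ x ∂μ, ∀ k : ℕ, ∀ᶠ n in atTop,
      birkhoffAverage ℝ T g n x < ∫ x, g x ∂μ + 1 / ((k : ℝ) + 1) :=
    ae_all_iff.2 fun k => ae_eventually_birkhoffAverage_lt hT hgm hg Nat.one_div_pos_of_nat
  have h2 : ∀ᵐ x ∂μ, ∀ k : ℕ, ∀ᶠ n in atTop,
      birkhoffAverage ℝ T (-g) n x < ∫ x, (-g) x ∂μ + 1 / ((k : ℝ) + 1) :=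
    ae_all_iff.2 fun k => ae_eventually_birkhoffAverage_lt hT hgm.neg hg.neg Nat.one_div_pos_of_nat
  filter_upwards [h1, h2] with x hx1 hx2
  refine tendsto_order.2 ⟨fun a ha => ?_, fun a ha => ?_⟩
  · obtain ⟨k, hk⟩ := exists_nat_one_div_lt (sub_pos.2 ha)
    filter_upwards [hx2 k] with n hn
    simp only [birkhoffAverage, birkhoffSum_neg, Pi.neg_apply, integral_neg, smul_neg] at hn ⊢
    linarith
  · obtain ⟨k, hk⟩ := exists_nat_one_div_lt (sub_pos.2 ha)
    filter_upwards [hx1 k] with n hn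
    linarith

end Birkhoff

/-! ### Krein-Milman for invariant measures, and generic points. -/

section Compactness

open Topology BoundedContinuousFunction

variable {Z : Type*} [TopologicalSpace Z] [MeasurableSpace Z] [BorelSpace Z]

/-- A probability measure as a functional on bounded continuous functions. -/
noncomputable def toFunctional (μ : ProbabilityMeasure Z) : (Z →ᵇ ℝ) → ℝ :=
  fun f => ∫ x, f x ∂(μ : Measure Z)

theorem continuous_toFunctional : Continuous (toFunctional (Z := Z)) :=
  continuous_pi fun f => ProbabilityMeasure.continuous_integral_boundedContinuousFunction f

/-- With continuity, this embeds compact sets of measures in a locally convex space of functionals,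
where Krein-Milman applies. -/
theorem toFunctional_injective [HasOuterApproxClosed Z] :
    Function.Injective (toFunctional (Z := Z)) := fun _ _ h =>
  ProbabilityMeasure.toMeasure_injective
    (ext_of_forall_integral_eq_of_IsFiniteMeasure fun f => congrFun h f)

theorem toFunctional_of_eq_add {μ ν ρ : ProbabilityMeasure Z} {a b : ℝ≥0∞} (ha : a ≠ ∞)
    (hb : b ≠ ∞) (h : (ρ : Measure Z) = a • (μ : Measure Z) + b • (ν : Measure Z)) :
    toFunctional ρ = a.toReal • toFunctional μ + b.toReal • toFunctional ν := by
  ext f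
  simp only [toFunctional, h, Pi.add_apply, Pi.smul_apply]
  rw [integral_add_measure ((f.integrable _).smul_measure ha) ((f.integrable _).smul_measure hb),
    integral_smul_measure, integral_smul_measure]

theorem exists_eq_smul_add_smul {Z : Type*} [MeasurableSpace Z] (μ ν : ProbabilityMeasure Z)
    {a b : ℝ≥0∞} (hab : a + b = 1) :
    ∃ ρ : ProbabilityMeasure Z, (ρ : Measure Z) = a • (μ : Measure Z) + b • (ν : Measure Z) :=
  ⟨⟨a • (μ : Measure Z) + b • (ν : Measure Z), ⟨by simp [hab]⟩⟩, rfl⟩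

/-- A set of probability measures is convex as a set of measures. -/
def IsConvexSet {Z : Type*} [MeasurableSpace Z] (K : Set (ProbabilityMeasure Z)) : Prop :=
  ∀ μ ∈ K, ∀ ν ∈ K, ∀ (ρ : ProbabilityMeasure Z) (a b : ℝ≥0∞), a + b = 1 →
    (ρ : Measure Z) = a • (μ : Measure Z) + b • (ν : Measure Z) → ρ ∈ K

theorem IsConvexSet.convex_image {K : Set (ProbabilityMeasure Z)} (hK : IsConvexSet K) :
    Convex ℝ (toFunctional '' K) := by
  rintro _ ⟨μ, hμ, rfl⟩ _ ⟨ν, hν, rfl⟩ a b ha hb hab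
  have hab' : ENNReal.ofReal a + ENNReal.ofReal b = 1 := by
    rw [← ENNReal.ofReal_add ha hb, hab, ENNReal.ofReal_one]
  obtain ⟨ρ, hρ⟩ := exists_eq_smul_add_smul μ ν hab'
  refine ⟨ρ, hK μ hμ ν hν ρ _ _ hab' hρ, ?_⟩
  rw [toFunctional_of_eq_add ENNReal.ofReal_ne_top ENNReal.ofReal_ne_top hρ,
    ENNReal.toReal_ofReal ha, ENNReal.toReal_ofReal hb]

/-- `F` is a face of the set of all `T`-invariant probability measures. -/
def IsInvariantFace {Z : Type*} [MeasurableSpace Z] (T : Z → Z) (F : Set (ProbabilityMeasure Z)) :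
    Prop :=
  (∀ μ ∈ F, MeasurePreserving T (μ : Measure Z) μ) ∧
    ∀ ρ ∈ F, ∀ μ ν : ProbabilityMeasure Z, MeasurePreserving T (μ : Measure Z) μ →
      MeasurePreserving T (ν : Measure Z) ν → ∀ a b : ℝ≥0∞, 0 < a → 0 < b → a + b = 1 →
      (ρ : Measure Z) = a • (μ : Measure Z) + b • (ν : Measure Z) → μ ∈ F ∧ ν ∈ F

/-- Any decomposition into invariant measures stays inside a face, so a point extreme in the face is
extreme among all invariant measures, that is, ergodic. -/
theorem IsInvariantFace.ergodic_of_mem_extremePoints [HasOuterApproxClosed Z] {T : Z → Z}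
    {F : Set (ProbabilityMeasure Z)} (hF : IsInvariantFace T F) {μ : ProbabilityMeasure Z}
    (hμ : toFunctional μ ∈ (toFunctional '' F).extremePoints ℝ) :
    μ ∈ F ∧ Ergodic T (μ : Measure Z) := by
  have hμF : μ ∈ F := by
    obtain ⟨μ', h1, h2⟩ := hμ.1
    rwa [← toFunctional_injective h2]
  refine ⟨hμF, Ergodic.of_mem_extremePoints (mem_extremePoints_iff_left.2
    ⟨⟨hF.1 μ hμF, inferInstance⟩, ?_⟩)⟩
  rintro ν₁ ⟨h₁, hp₁⟩ ν₂ ⟨h₂, hp₂⟩ ⟨a, b, ha, hb, hab, h⟩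
  have ha' : a ≠ ∞ := fun h => by simp [h] at hab
  have hb' : b ≠ ∞ := fun h => by simp [h] at hab
  obtain ⟨hm₁, hm₂⟩ := hF.2 μ hμF ⟨ν₁, hp₁⟩ ⟨ν₂, hp₂⟩ h₁ h₂ a b ha hb hab h.symm
  have key := hμ.2 ⟨_, hm₁, rfl⟩ ⟨_, hm₂, rfl⟩ ⟨a.toReal, b.toReal, ENNReal.toReal_pos ha.ne' ha',
    ENNReal.toReal_pos hb.ne' hb', by rw [← ENNReal.toReal_add ha' hb', hab, ENNReal.toReal_one],
    (toFunctional_of_eq_add ha' hb' h.symm).symm⟩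
  exact congrArg ProbabilityMeasure.toMeasure (toFunctional_injective key)


theorem isClosed_setOf_measurePreserving [HasOuterApproxClosed Z] {T : Z → Z} (hT : Continuous T) :
    IsClosed {μ : ProbabilityMeasure Z | MeasurePreserving T (μ : Measure Z) μ} := by
  have h := isClosed_eq (ProbabilityMeasure.continuous_map hT) continuous_id
  convert h using 1
  ext μ
  simp only [Set.mem_ofPred_eq, id]
  constructor
  · intro h
    exact Subtype.ext h.map_eq
  · intro h
    exact ⟨hT.measurable, congrArg ProbabilityMeasure.toMeasure h⟩

theorem isClosed_setOf_measure_eq_one [HasOuterApproxClosed Z] {C : Set Z} (hC : IsClosed C) :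
    IsClosed {μ : ProbabilityMeasure Z | (μ : Measure Z) C = 1} := by
  rw [isClosed_iff_ultrafilter]
  intro μ U hU hmem
  have h := ProbabilityMeasure.limsup_measure_closed_le_of_tendsto (μs := id) hU hC
  refine le_antisymm prob_le_one ?_
  exact ((limsup_congr (v := fun _ => 1) hmem).trans (limsup_const _)).symm.le.trans h

/-- A clopen set has empty frontier, so the portmanteau theorem applies at every measure. -/
theorem continuous_measure_of_isClopen [HasOuterApproxClosed Z] {D : Set Z} (hD : IsClopen D) :
    Continuous fun μ : ProbabilityMeasure Z => (μ : Measure Z) D :=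
  continuous_iff_continuousAt.2 fun _ =>
    ProbabilityMeasure.tendsto_measure_of_null_frontier_of_tendsto' tendsto_id (by simp [hD])

variable [CompactSpace Z] [TopologicalSpace.MetrizableSpace Z]

theorem IsInvariantFace.exists_ergodic {T : Z → Z} {F : Set (ProbabilityMeasure Z)}
    (hF : IsInvariantFace T F) (hc : IsClosed F) (hne : F.Nonempty) :
    ∃ μ ∈ F, Ergodic T (μ : Measure Z) := by
  obtain ⟨φ, hφ⟩ := (hc.isCompact.image continuous_toFunctional).extremePoints_nonempty
    (hne.image _)
  obtain ⟨μ, -, rfl⟩ := hφ.1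
  exact ⟨μ, hF.ergodic_of_mem_extremePoints hφ⟩

/-- Krein-Milman for invariant measures. -/
theorem IsInvariantFace.subset_of_forall_ergodic_mem {T : Z → Z} {F G : Set (ProbabilityMeasure Z)}
    (hF : IsInvariantFace T F) (hFc : IsClosed F) (hFconv : IsConvexSet F) (hGc : IsClosed G)
    (hGconv : IsConvexSet G) (h : ∀ μ ∈ F, Ergodic T (μ : Measure Z) → μ ∈ G) : F ⊆ G := by
  intro μ hμ
  have h1 : (toFunctional '' F).extremePoints ℝ ⊆ toFunctional '' G := by
    intro φ hφ
    obtain ⟨ν, -, rfl⟩ := hφ.1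
    obtain ⟨h2, h3⟩ := hF.ergodic_of_mem_extremePoints hφ
    exact ⟨ν, h ν h2 h3, rfl⟩
  have h2 : toFunctional μ ∈ toFunctional '' G := by
    refine closure_minimal (convexHull_min h1 hGconv.convex_image)
      (hGc.isCompact.image continuous_toFunctional).isClosed ?_
    rw [closure_convexHull_extremePoints (hFc.isCompact.image continuous_toFunctional)
      hFconv.convex_image]
    exact ⟨μ, hμ, rfl⟩
  obtain ⟨ν, hν, hνμ⟩ := h2
  rwa [← toFunctional_injective hνμ]

/-- The null set must not depend on `f`: Birkhoff's theorem is applied on a countable dense subset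
of `C(Z, ℝ)`, and uniform approximation gives the rest. -/
theorem ae_forall_tendsto_birkhoffAverage {T : Z → Z} {μ : ProbabilityMeasure Z}
    (hT : Ergodic T (μ : Measure Z)) :
    ∀ᵐ x ∂(μ : Measure Z), ∀ f : Z →ᵇ ℝ,
      Tendsto (fun n => birkhoffAverage ℝ T f n x) atTop (𝓝 (∫ x, f x ∂(μ : Measure Z))) := by
  obtain ⟨D, hDc, hD⟩ := TopologicalSpace.exists_countable_dense C(Z, ℝ)
  have h : ∀ᵐ x ∂(μ : Measure Z), ∀ g ∈ D,
      Tendsto (fun n => birkhoffAverage ℝ T g n x) atTop (𝓝 (∫ x, g x ∂(μ : Measure Z))) :=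
    (ae_ball_iff hDc).2 fun g _ => ae_tendsto_birkhoffAverage hT g.continuous.measurable
      ((mkOfCompact g).integrable _)
  filter_upwards [h] with x hx f
  rw [Metric.tendsto_atTop]
  intro ε hε
  obtain ⟨g, hgD, hg⟩ := hD.exists_dist_lt (f : C(Z, ℝ)) (ε := ε / 3) (by positivity)
  obtain ⟨N, hN⟩ := Metric.tendsto_atTop.1 (hx g hgD) (ε / 3) (by positivity)
  have hfg : ∀ z, |f z - g z| ≤ ε / 3 := fun z =>
    (ContinuousMap.dist_apply_le_dist (f := (f : C(Z, ℝ))) z).trans hg.le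
  refine ⟨N, fun n hn => ?_⟩
  have h1 : |birkhoffAverage ℝ T f n x - birkhoffAverage ℝ T g n x| ≤ ε / 3 := by
    rcases Nat.eq_zero_or_pos n with rfl | hn0
    · simp; positivity
    have hn0' : (0 : ℝ) < n := by exact_mod_cast hn0
    rw [birkhoffAverage, birkhoffAverage, ← smul_sub, smul_eq_mul, abs_mul, abs_of_pos (by positivity),
      inv_mul_le_iff₀ hn0', birkhoffSum, birkhoffSum, ← Finset.sum_sub_distrib]
    refine (Finset.abs_sum_le_sum_abs _ _).trans ((Finset.sum_le_sum fun i _ => hfg _).trans ?_)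
    simp
  have h2 : |∫ x, g x ∂(μ : Measure Z) - ∫ x, f x ∂(μ : Measure Z)| ≤ ε / 3 := by
    have hgi : Integrable g (μ : Measure Z) := (mkOfCompact g).integrable _
    rw [abs_sub_comm, ← integral_sub (f.integrable _) hgi]
    refine (norm_integral_le_of_norm_le_const (C := ε / 3) (f := fun z => f z - g z)
      (ae_of_all _ hfg)).trans ?_
    simp
  have h3 := hN n hn
  rw [Real.dist_eq] at h3 ⊢
  rw [abs_le] at h1 h2
  rw [abs_lt] at h3 ⊢
  constructor <;> linarith [h1.1, h1.2, h2.1, h2.2, h3.1, h3.2]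

end Compactness

/-! ### The closed convex face of invariant measures on a set. -/

section InvariantOn

open Topology

/-- A weighted average reaching its extremal value forces each term to be extremal. This is the
source of both face properties below: full mass on a set, and minimal cost. -/
theorem eq_of_add_mul_le {a b p q p' q' : ℝ≥0∞} (ha : 0 < a) (ha' : a ≠ ∞) (hb : b ≠ ∞)
    (hp : p ≤ p') (hq : q ≤ q') (hq' : q' ≠ ∞)
    (h : a * p' + b * q' ≤ a * p + b * q) : p = p' := by
  by_contra hne
  have h1 : a * p < a * p' := (ENNReal.mul_lt_mul_iff_right ha.ne' ha').2 (lt_of_le_of_ne hp hne)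
  have h2 : b * q ≤ b * q' := by gcongr
  exact absurd h (not_le.2 (ENNReal.add_lt_add_of_lt_of_le
    (ENNReal.mul_ne_top hb (ne_top_of_le_ne_top hq' hq)) h1 h2))

/-- The `T`-invariant probability measures supported on `X`. -/
def invariantOn {Z : Type*} [MeasurableSpace Z] (T : Z → Z) (X : Set Z) :
    Set (ProbabilityMeasure Z) :=
  {μ | MeasurePreserving T (μ : Measure Z) (μ : Measure Z) ∧ (μ : Measure Z) X = 1}

variable {Z : Type*} [MeasurableSpace Z] {T : Z → Z}

theorem isInvariantFace_invariantOn (X : Set Z) : IsInvariantFace T (invariantOn T X) := by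
  refine ⟨fun μ hμ => hμ.1, fun ρ hρ μ ν hμ hν a b ha hb hab h => ?_⟩
  have key := hρ.2
  simp only [h, Measure.add_apply, Measure.smul_apply, smul_eq_mul] at key
  have ha' : a ≠ ∞ := fun h => by simp [h] at hab
  have hb' : b ≠ ∞ := fun h => by simp [h] at hab
  refine ⟨⟨hμ, ?_⟩, ⟨hν, ?_⟩⟩
  · exact eq_of_add_mul_le ha ha' hb' prob_le_one prob_le_one ENNReal.one_ne_top
      (by rw [key, mul_one, mul_one, hab])
  · exact eq_of_add_mul_le hb hb' ha' prob_le_one prob_le_one ENNReal.one_ne_top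
      (by rw [add_comm, add_comm (b * _), key, mul_one, mul_one, hab])

theorem isConvexSet_invariantOn (hT : Measurable T) (X : Set Z) :
    IsConvexSet (invariantOn T X) := by
  intro μ hμ ν hν ρ a b hab h
  refine ⟨⟨hT, ?_⟩, ?_⟩
  · rw [h, Measure.map_add _ _ hT, Measure.map_smul, Measure.map_smul, hμ.1.map_eq, hν.1.map_eq]
  · rw [h]
    simp [hμ.2, hν.2, hab]

theorem isClosed_invariantOn [TopologicalSpace Z] [BorelSpace Z] [HasOuterApproxClosed Z]
    (hT : Continuous T) {X : Set Z} (hX : IsClosed X) : IsClosed (invariantOn T X) :=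
  (isClosed_setOf_measurePreserving hT).inter (isClosed_setOf_measure_eq_one hX)

end InvariantOn

/-! ### Joinings, their cost, and the reduction to ergodic measures. -/

section Joinings

open Topology

variable {A : Type*}

/-- The product of the shift with itself. -/
abbrev pairShift : (ℕ → A) × (ℕ → A) → (ℕ → A) × (ℕ → A) := Prod.map shiftMap shiftMap

/-- The pairs of sequences that disagree at coordinate `0`. -/
def zeroNe (A : Type*) : Set ((ℕ → A) × (ℕ → A)) := {p | p.1 0 ≠ p.2 0}

variable [TopologicalSpace A]

theorem continuous_shiftMap : Continuous (shiftMap (A := A)) := by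
  refine continuous_pi fun j => ?_
  simp only [shiftMap_apply]
  exact continuous_apply _

theorem continuous_pairShift : Continuous (pairShift (A := A)) :=
  continuous_shiftMap.prodMap continuous_shiftMap

theorem isClopen_zeroNe [DiscreteTopology A] : IsClopen (zeroNe A) := by
  have h : Continuous fun p : (ℕ → A) × (ℕ → A) => (p.1 0, p.2 0) :=
    ((continuous_apply 0).comp continuous_fst).prodMk ((continuous_apply 0).comp continuous_snd)
  exact (isClopen_discrete {q : A × A | q.1 ≠ q.2}).preimage h

variable [Finite A] [DiscreteTopology A] [MeasurableSpace A] [BorelSpace A]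

theorem lintegral_dZero (lam : Measure ((ℕ → A) × (ℕ → A))) :
    ∫⁻ p, dZero p.1 p.2 ∂lam = lam (zeroNe A) := by
  rw [← lintegral_indicator_one isClopen_zeroNe.1.measurableSet]
  refine lintegral_congr fun p => ?_
  by_cases h : p.1 0 = p.2 0 <;> simp [dZero, zeroNe, h]

theorem measurable_shiftMap : Measurable (shiftMap (A := A)) := continuous_shiftMap.measurable

/-- The first marginal. -/
noncomputable def fstMarginal (lam : ProbabilityMeasure ((ℕ → A) × (ℕ → A))) :
    ProbabilityMeasure (ℕ → A) :=
  lam.map continuous_fst.aemeasurable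

/-- The second marginal. -/
noncomputable def sndMarginal (lam : ProbabilityMeasure ((ℕ → A) × (ℕ → A))) :
    ProbabilityMeasure (ℕ → A) :=
  lam.map continuous_snd.aemeasurable

theorem continuous_fstMarginal : Continuous (fstMarginal (A := A)) :=
  ProbabilityMeasure.continuous_map continuous_fst

variable {lam : ProbabilityMeasure ((ℕ → A) × (ℕ → A))}

theorem measurePreserving_fst :
    MeasurePreserving Prod.fst (lam : Measure ((ℕ → A) × (ℕ → A))) (fstMarginal lam) :=
  ⟨measurable_fst, rfl⟩

theorem measurePreserving_snd :
    MeasurePreserving Prod.snd (lam : Measure ((ℕ → A) × (ℕ → A))) (sndMarginal lam) :=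
  ⟨measurable_snd, rfl⟩

theorem measurePreserving_fstMarginal
    (h : MeasurePreserving pairShift (lam : Measure ((ℕ → A) × (ℕ → A))) lam) :
    MeasurePreserving shiftMap (fstMarginal lam : Measure (ℕ → A)) (fstMarginal lam) :=
  MeasurePreserving.of_semiconj measurePreserving_fst h (fun _ => rfl) measurable_shiftMap

theorem measurePreserving_sndMarginal
    (h : MeasurePreserving pairShift (lam : Measure ((ℕ → A) × (ℕ → A))) lam) :
    MeasurePreserving shiftMap (sndMarginal lam : Measure (ℕ → A)) (sndMarginal lam) :=
  MeasurePreserving.of_semiconj measurePreserving_snd h (fun _ => rfl) measurable_shiftMap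

theorem sndMarginal_mem_invariantMeasures {Y : Set (ℕ → A)} (hY : IsClosed Y)
    (h : lam ∈ invariantOn pairShift (Prod.snd ⁻¹' Y)) :
    sndMarginal lam ∈ invariantMeasures Y :=
  ⟨measurePreserving_sndMarginal h.1,
    (measurePreserving_snd.measure_preimage hY.measurableSet.nullMeasurableSet).symm.trans h.2⟩

theorem mem_invariantOn_of_sndMarginal_mem {Y : Set (ℕ → A)} (hY : IsClosed Y)
    (h : MeasurePreserving pairShift (lam : Measure ((ℕ → A) × (ℕ → A))) lam)
    (hlam : sndMarginal lam ∈ invariantMeasures Y) :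
    lam ∈ invariantOn pairShift (Prod.snd ⁻¹' Y) :=
  ⟨h, (measurePreserving_snd.measure_preimage hY.measurableSet.nullMeasurableSet).trans hlam.2⟩

theorem dMeas_marginals_le
    (h : MeasurePreserving pairShift (lam : Measure ((ℕ → A) × (ℕ → A))) lam) :
    dMeas (fstMarginal lam) (sndMarginal lam) ≤ (lam : Measure ((ℕ → A) × (ℕ → A))) (zeroNe A) := by
  rw [← lintegral_dZero]
  exact iInf₂_le (lam : Measure ((ℕ → A) × (ℕ → A))) ⟨h, rfl, rfl⟩

theorem exists_joining_of_dMeas_lt {μ ν : ProbabilityMeasure (ℕ → A)} {r : ℝ≥0∞}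
    (h : dMeas μ ν < r) :
    ∃ lam : ProbabilityMeasure ((ℕ → A) × (ℕ → A)),
      MeasurePreserving pairShift (lam : Measure ((ℕ → A) × (ℕ → A))) lam ∧
      fstMarginal lam = μ ∧ sndMarginal lam = ν ∧
      (lam : Measure ((ℕ → A) × (ℕ → A))) (zeroNe A) < r := by
  simp only [dMeas, iInf_lt_iff] at h
  obtain ⟨lam, hj, hlt⟩ := h
  rw [lintegral_dZero] at hlt
  -- Joinings are not assumed normalized; the total mass is read off from the first marginal.
  have hp : IsProbabilityMeasure lam := by
    have : IsProbabilityMeasure (lam.map Prod.fst) := by rw [hj.map_fst]; infer_instance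
    exact Measure.isProbabilityMeasure_of_map (f := Prod.fst)
  exact ⟨⟨lam, hp⟩, hj.invariant, ProbabilityMeasure.toMeasure_injective hj.map_fst,
    ProbabilityMeasure.toMeasure_injective hj.map_snd, hlt⟩

/-- If `μ` is ergodic, the second marginal of a joining of `μ` with some measure on `Y` may be
replaced by an ergodic measure on `Y` without increasing the cost. -/
theorem exists_ergodic_dMeas_le {Y : Set (ℕ → A)} (hY : IsClosed Y)
    (hlam : lam ∈ invariantOn pairShift (Prod.snd ⁻¹' Y))
    (hμ : Ergodic shiftMap (fstMarginal lam : Measure (ℕ → A))) :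
    ∃ ν ∈ ergodicMeasures Y, dMeas (fstMarginal lam) ν ≤
      (lam : Measure ((ℕ → A) × (ℕ → A))) (zeroNe A) := by
  set K : Set (ProbabilityMeasure ((ℕ → A) × (ℕ → A))) :=
    invariantOn pairShift (Prod.snd ⁻¹' Y) ∩ {κ | fstMarginal κ = fstMarginal lam} with hK
  have hKc : IsClosed K := (isClosed_invariantOn continuous_pairShift
    (hY.preimage continuous_snd)).inter (isClosed_eq continuous_fstMarginal continuous_const)
  have hcost := continuous_measure_of_isClopen (isClopen_zeroNe (A := A))
  obtain ⟨κ₀, hκ₀, hmin⟩ := hKc.isCompact.exists_isMinOn ⟨lam, hlam, rfl⟩ hcost.continuousOn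
  set m := (κ₀ : Measure ((ℕ → A) × (ℕ → A))) (zeroNe A) with hm
  have hmin' : ∀ κ ∈ K, m ≤ (κ : Measure ((ℕ → A) × (ℕ → A))) (zeroNe A) := fun κ hκ => hmin hκ
  -- `F` is the set of cost minimizers in `K`. Components of a minimizer keep the first marginal,
  -- since an ergodic measure is extreme, and keep the cost, since neither can go below `m`.
  set F : Set (ProbabilityMeasure ((ℕ → A) × (ℕ → A))) :=
    K ∩ {κ | (κ : Measure ((ℕ → A) × (ℕ → A))) (zeroNe A) ≤ m} with hF
  have hface : IsInvariantFace pairShift F := by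
    refine ⟨fun κ hκ => hκ.1.1.1, fun ρ hρ κ₁ κ₂ h₁ h₂ a b ha hb hab h => ?_⟩
    have ha' : a ≠ ∞ := fun h => by simp [h] at hab
    have hb' : b ≠ ∞ := fun h => by simp [h] at hab
    obtain ⟨hi₁, hi₂⟩ := (isInvariantFace_invariantOn _).2 ρ hρ.1.1 κ₁ κ₂ h₁ h₂ a b ha hb hab h
    have hext := hμ.mem_extremePoints
    have hcomb : a • (fstMarginal κ₁ : Measure (ℕ → A)) + b • (fstMarginal κ₂ : Measure (ℕ → A)) =
        fstMarginal lam := by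
      rw [← hρ.1.2]
      change a • Measure.map Prod.fst _ + b • Measure.map Prod.fst _ = Measure.map Prod.fst _
      rw [h, Measure.map_add _ _ measurable_fst, Measure.map_smul, Measure.map_smul]
    have hf₁ : fstMarginal κ₁ = fstMarginal lam := ProbabilityMeasure.toMeasure_injective
      (hext.2 ⟨measurePreserving_fstMarginal h₁, inferInstance⟩
        ⟨measurePreserving_fstMarginal h₂, inferInstance⟩ ⟨a, b, ha, hb, hab, hcomb⟩)
    have hf₂ : fstMarginal κ₂ = fstMarginal lam := ProbabilityMeasure.toMeasure_injective
      (hext.2 ⟨measurePreserving_fstMarginal h₂, inferInstance⟩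
        ⟨measurePreserving_fstMarginal h₁, inferInstance⟩
        ⟨b, a, hb, ha, by rw [add_comm, hab], by rw [add_comm, hcomb]⟩)
    have hK₁ : κ₁ ∈ K := ⟨hi₁, hf₁⟩
    have hK₂ : κ₂ ∈ K := ⟨hi₂, hf₂⟩
    have hle : a * (κ₁ : Measure ((ℕ → A) × (ℕ → A))) (zeroNe A) +
        b * (κ₂ : Measure ((ℕ → A) × (ℕ → A))) (zeroNe A) ≤ a * m + b * m := by
      rw [← add_mul, hab, one_mul]
      have h3 : (ρ : Measure ((ℕ → A) × (ℕ → A))) (zeroNe A) ≤ m := hρ.2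
      rwa [h] at h3
    refine ⟨⟨hK₁, ?_⟩, ⟨hK₂, ?_⟩⟩
    · exact (eq_of_add_mul_le ha ha' hb' (hmin' _ hK₁) (hmin' _ hK₂) 
        (measure_ne_top _ _) hle).ge
    · exact (eq_of_add_mul_le hb hb' ha' (hmin' _ hK₂) (hmin' _ hK₁) 
        (measure_ne_top _ _) (by rwa [add_comm, add_comm (b * m)])).ge
  obtain ⟨κ, hκ, herg⟩ := hface.exists_ergodic
    (hKc.inter (isClosed_le hcost continuous_const)) ⟨κ₀, hκ₀, hm.ge⟩
  refine ⟨sndMarginal κ, ⟨sndMarginal_mem_invariantMeasures hY hκ.1.1,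
    measurePreserving_snd.ergodic_of_ergodic_semiconj herg measurable_shiftMap fun _ => rfl⟩, ?_⟩
  rw [← hκ.1.2]
  exact (dMeas_marginals_le hκ.1.1.1).trans (hκ.2.trans (hmin' _ ⟨hlam, rfl⟩))

theorem iSup_ergodicMeasures_le_iSup_invariantMeasures (X : Set (ℕ → A)) {Y : Set (ℕ → A)}
    (hY : IsClosed Y) :
    ⨆ μ ∈ ergodicMeasures X, ⨅ ν ∈ ergodicMeasures Y, dMeas μ ν ≤
      ⨆ μ ∈ invariantMeasures X, ⨅ ν ∈ invariantMeasures Y, dMeas μ ν := by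
  refine iSup₂_le fun μ hμ => le_iSup₂_of_le μ hμ.1 (le_iInf₂ fun ν hν => ?_)
  refine le_of_forall_gt fun r hr => ?_
  obtain ⟨lam, hinv, rfl, rfl, hlt⟩ := exists_joining_of_dMeas_lt hr
  obtain ⟨ν', hν', hle⟩ := exists_ergodic_dMeas_le hY
    (mem_invariantOn_of_sndMarginal_mem hY hinv hν) hμ.2
  exact ((iInf₂_le ν' hν').trans hle).trans_lt hlt

theorem iSup_invariantMeasures_le_iSup_ergodicMeasures {X Y : Set (ℕ → A)} (hX : IsClosed X)
    (hY : IsClosed Y) :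
    ⨆ μ ∈ invariantMeasures X, ⨅ ν ∈ invariantMeasures Y, dMeas μ ν ≤
      ⨆ μ ∈ ergodicMeasures X, ⨅ ν ∈ ergodicMeasures Y, dMeas μ ν := by
  refine le_of_forall_gt_imp_ge_of_dense fun r hr => ?_
  -- The cost bound `r` is closed and affine, so `fstMarginal '' K` is compact and convex:
  -- Krein-Milman only requires it to contain the ergodic measures on `X`.
  set K : Set (ProbabilityMeasure ((ℕ → A) × (ℕ → A))) :=
    invariantOn pairShift (Prod.snd ⁻¹' Y) ∩
      {κ | (κ : Measure ((ℕ → A) × (ℕ → A))) (zeroNe A) ≤ r} with hK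
  have hKc : IsClosed K := (isClosed_invariantOn continuous_pairShift
    (hY.preimage continuous_snd)).inter
    (isClosed_le (continuous_measure_of_isClopen isClopen_zeroNe) continuous_const)
  have hGconv : IsConvexSet (fstMarginal '' K) := by
    rintro _ ⟨κ₁, h₁, rfl⟩ _ ⟨κ₂, h₂, rfl⟩ ρ a b hab h
    obtain ⟨κ, hκ⟩ := exists_eq_smul_add_smul κ₁ κ₂ hab
    refine ⟨κ, ⟨isConvexSet_invariantOn continuous_pairShift.measurable _ κ₁ h₁.1 κ₂ h₂.1 κ a b
      hab hκ, ?_⟩, ProbabilityMeasure.toMeasure_injective ?_⟩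
    · have h3 : (κ₁ : Measure ((ℕ → A) × (ℕ → A))) (zeroNe A) ≤ r := h₁.2
      have h4 : (κ₂ : Measure ((ℕ → A) × (ℕ → A))) (zeroNe A) ≤ r := h₂.2
      change (κ : Measure ((ℕ → A) × (ℕ → A))) (zeroNe A) ≤ r
      rw [hκ]
      calc a * (κ₁ : Measure ((ℕ → A) × (ℕ → A))) (zeroNe A) +
          b * (κ₂ : Measure ((ℕ → A) × (ℕ → A))) (zeroNe A) ≤ a * r + b * r := by gcongr
        _ = r := by rw [← add_mul, hab, one_mul]
    · rw [h]
      change Measure.map Prod.fst _ = a • Measure.map Prod.fst _ + b • Measure.map Prod.fst _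
      rw [hκ, Measure.map_add _ _ measurable_fst, Measure.map_smul, Measure.map_smul]
  have hsub : invariantOn shiftMap X ⊆ fstMarginal '' K := by
    refine (isInvariantFace_invariantOn X).subset_of_forall_ergodic_mem
      (isClosed_invariantOn continuous_shiftMap hX)
      (isConvexSet_invariantOn measurable_shiftMap X)
      (hKc.isCompact.image continuous_fstMarginal).isClosed hGconv fun μ hμ herg => ?_
    have hlt := (le_iSup₂ (f := fun μ (_ : μ ∈ ergodicMeasures X) =>
      ⨅ ν ∈ ergodicMeasures Y, dMeas μ ν) μ ⟨hμ, herg⟩).trans_lt hr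
    simp only [iInf_lt_iff] at hlt
    obtain ⟨ν, hν, hlt⟩ := hlt
    obtain ⟨lam, hinv, rfl, rfl, hcost⟩ := exists_joining_of_dMeas_lt hlt
    exact ⟨lam, ⟨mem_invariantOn_of_sndMarginal_mem hY hinv hν.1, hcost.le⟩, rfl⟩
  refine iSup₂_le fun μ hμ => ?_
  obtain ⟨lam, hlam, rfl⟩ := hsub hμ
  exact (iInf₂_le _ (sndMarginal_mem_invariantMeasures hY hlam.1)).trans
    ((dMeas_marginals_le hlam.1.1).trans hlam.2)

end Joinings

/-! ### Empirical measures and invariance of their limits. -/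

section Empirical

open Topology BoundedContinuousFunction

/-- The empirical measure of the first `n + 1` points of the orbit of `z`. -/
noncomputable def empirical {Z : Type*} [MeasurableSpace Z] (T : Z → Z) (z : Z) (n : ℕ) :
    ProbabilityMeasure Z :=
  ⟨((n + 1 : ℕ) : ℝ≥0∞)⁻¹ • ∑ j ∈ Finset.range (n + 1), Measure.dirac (T^[j] z), ⟨by
    simp only [Measure.smul_apply, Measure.coe_finsetSum, Finset.sum_apply, measure_univ,
      Finset.sum_const, Finset.card_range, smul_eq_mul, nsmul_eq_mul, mul_one]
    exact ENNReal.inv_mul_cancel (by simp) (ENNReal.natCast_ne_top _)⟩⟩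

variable {Z : Type*} [MeasurableSpace Z]

theorem empirical_apply (T : Z → Z) (z : Z) (n : ℕ) {D : Set Z} (hD : MeasurableSet D) :
    (empirical T z n : Measure Z) D =
      ((n + 1 : ℕ) : ℝ≥0∞)⁻¹ * ∑ j ∈ Finset.range (n + 1), D.indicator 1 (T^[j] z) := by
  simp only [empirical, ProbabilityMeasure.coe_mk, Measure.smul_apply, Measure.coe_finsetSum,
    Finset.sum_apply, smul_eq_mul, Measure.dirac_apply' _ hD]

theorem empirical_eq_one {T : Z → Z} {C : Set Z} (hC : MeasurableSet C) (hT : Set.MapsTo T C C)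
    {z : Z} (hz : z ∈ C) (n : ℕ) : (empirical T z n : Measure Z) C = 1 := by
  rw [empirical_apply T z n hC, Finset.sum_congr rfl (g := fun _ => 1) fun j _ =>
    Set.indicator_of_mem (hT.iterate j hz) _]
  simp only [Finset.sum_const, Finset.card_range, nsmul_eq_mul, mul_one]
  exact ENNReal.inv_mul_cancel (by simp) (ENNReal.natCast_ne_top _)

variable [TopologicalSpace Z] [BorelSpace Z]

theorem integral_empirical (T : Z → Z) (z : Z) (n : ℕ) (f : Z →ᵇ ℝ) :
    ∫ x, f x ∂(empirical T z n : Measure Z) = birkhoffAverage ℝ T f (n + 1) z := by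
  simp only [empirical, ProbabilityMeasure.coe_mk]
  rw [integral_smul_measure, integral_finsetSum_measure fun i _ => f.integrable _]
  simp only [birkhoffAverage, birkhoffSum, integral_dirac' _ _ f.continuous.stronglyMeasurable,
    ENNReal.toReal_inv, ENNReal.toReal_natCast]

theorem measurePreserving_of_tendsto_empirical [HasOuterApproxClosed Z] {T : Z → Z}
    (hT : Continuous T) {z : Z} {L : Filter ℕ} [L.NeBot] (hL : L ≤ atTop) {μ : ProbabilityMeasure Z}
    (h : Tendsto (empirical T z) L (𝓝 μ)) : MeasurePreserving T (μ : Measure Z) μ := by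
  refine ⟨hT.measurable, ?_⟩
  have : IsProbabilityMeasure ((μ : Measure Z).map T) :=
    Measure.isProbabilityMeasure_map hT.measurable.aemeasurable
  refine ext_of_forall_integral_eq_of_IsFiniteMeasure fun f => ?_
  rw [integral_map hT.measurable.aemeasurable f.continuous.aestronglyMeasurable]
  have h1 := ProbabilityMeasure.tendsto_iff_forall_integral_tendsto.1 h f
  have h2 := ProbabilityMeasure.tendsto_iff_forall_integral_tendsto.1 h
    (f.compContinuous ⟨T, hT⟩)
  simp only [integral_empirical] at h1 h2
  -- The averages of `f` along the orbits of `T z` and `z` differ only by two boundary terms over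
  -- the length, which vanish in the limit as `f` is bounded.
  have h3 := ((tendsto_birkhoffAverage_apply_sub_birkhoffAverage ℝ (f := T) (g := f) (x := z)
    (f.isBounded_range.subset (by rintro _ ⟨n, rfl⟩; exact ⟨_, rfl⟩))).comp
    (tendsto_add_atTop_nat 1)).mono_left hL
  have h4 : ∀ n, birkhoffAverage ℝ T (f.compContinuous ⟨T, hT⟩) n z =
      birkhoffAverage ℝ T f n (T z) := fun n => by
    simp only [birkhoffAverage, birkhoffSum, compContinuous_apply, ContinuousMap.coe_mk]
    congr 1
    refine Finset.sum_congr rfl fun j _ => ?_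
    rw [← Function.iterate_succ_apply' T, ← Function.iterate_succ_apply]
  have h5 := h2.sub h1
  simp only [h4] at h5
  exact sub_eq_zero.1 (tendsto_nhds_unique h5 h3)

end Empirical

/-! ### From pairs of points to joinings. -/

section PointwiseComparison

open Topology BoundedContinuousFunction

variable {A : Type*}

theorem iterate_shiftMap_apply (x : ℕ → A) (j k : ℕ) : shiftMap^[j] x k = x (k + j) := by
  induction j generalizing x with
  | zero => rfl
  | succ j ih => rw [Function.iterate_succ_apply, ih, shiftMap_apply, add_assoc]

theorem iterate_pairShift (x y : ℕ → A) (j : ℕ) :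
    pairShift^[j] (x, y) = (shiftMap^[j] x, shiftMap^[j] y) := by
  rw [pairShift, Prod.map_iterate, Prod.map_apply]

variable [TopologicalSpace A] [Finite A] [DiscreteTopology A] [MeasurableSpace A] [BorelSpace A]

theorem empirical_zeroNe (x y : ℕ → A) (n : ℕ) :
    (empirical pairShift (x, y) n : Measure ((ℕ → A) × (ℕ → A))) (zeroNe A) =
      (mismatchCount (n + 1) x y : ℝ≥0∞) / ((n + 1 : ℕ) : ℝ≥0∞) := by
  classical
  have h1 : {j : ℕ | j < n + 1 ∧ x j ≠ y j} =
      ((Finset.range (n + 1)).filter fun j => x j ≠ y j : Finset ℕ) := by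
    ext j; simp
  rw [empirical_apply _ _ _ isClopen_zeroNe.1.measurableSet, ENNReal.div_eq_inv_mul, mismatchCount,
    h1, Set.ncard_coe_finset, Finset.card_filter, Nat.cast_sum]
  congr 1
  refine Finset.sum_congr rfl fun j _ => ?_
  simp only [Set.indicator, zeroNe, iterate_pairShift, iterate_shiftMap_apply, Set.mem_ofPred_eq,
    zero_add, Pi.one_apply, Nat.cast_ite, Nat.cast_one, Nat.cast_zero]

/-- A limit of empirical measures of `(x, y)` has first marginal `μ` because `x` is generic, and
lives over `Y` because the orbit of `y` does. A liminf suffices, since only some sequence of good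
times is needed. -/
theorem exists_joining_of_dLower_lt {μ : ProbabilityMeasure (ℕ → A)} {x y : ℕ → A}
    (hx : ∀ f : (ℕ → A) →ᵇ ℝ, Tendsto (fun n => birkhoffAverage ℝ shiftMap f n x) atTop
      (𝓝 (∫ z, f z ∂(μ : Measure (ℕ → A)))))
    {Y : Set (ℕ → A)} (hY : IsClosed Y) (hmaps : Set.MapsTo shiftMap Y Y) (hy : y ∈ Y) {r : ℝ≥0∞}
    (hr : dLower x y < r) :
    ∃ lam ∈ invariantOn (pairShift (A := A)) (Prod.snd ⁻¹' Y), fstMarginal lam = μ ∧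
      (lam : Measure ((ℕ → A) × (ℕ → A))) (zeroNe A) ≤ r := by
  have hfreq : ∃ᶠ n in atTop,
      (empirical pairShift (x, y) n : Measure ((ℕ → A) × (ℕ → A))) (zeroNe A) < r := by
    have h := frequently_lt_of_liminf_lt (by isBoundedDefault) hr
    rw [frequently_atTop] at h ⊢
    intro N
    -- `empirical` at `k` averages over `k + 1` points, so a positive time `n` is taken and `k = n -
    -- 1` used.
    obtain ⟨n, hn, hlt⟩ := h (N + 1)
    obtain ⟨k, rfl⟩ : ∃ k, n = k + 1 := ⟨n - 1, by omega⟩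
    exact ⟨k, by omega, by rwa [empirical_zeroNe]⟩
  have : (atTop ⊓ 𝓟 {n : ℕ | (empirical pairShift (x, y) n : Measure ((ℕ → A) × (ℕ → A)))
      (zeroNe A) < r}).NeBot := frequently_mem_iff_neBot.1 hfreq
  -- An ultrafilter on the good times plays the role of a convergent subsequence.
  obtain ⟨U, hU'⟩ := exists_ultrafilter_le (atTop ⊓ 𝓟 {n : ℕ |
    (empirical pairShift (x, y) n : Measure ((ℕ → A) × (ℕ → A))) (zeroNe A) < r})
  obtain ⟨hU, hUr⟩ := le_inf_iff.1 hU'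
  rw [le_principal_iff] at hUr
  obtain ⟨lam, -, hlam⟩ := isCompact_univ.ultrafilter_le_nhds
    (U.map (empirical (pairShift (A := A)) (x, y))) (by simp)
  have hlim : Tendsto (empirical (pairShift (A := A)) (x, y)) U (𝓝 lam) := hlam
  refine ⟨lam, ⟨measurePreserving_of_tendsto_empirical continuous_pairShift hU hlim, ?_⟩, ?_, ?_⟩
  · have hcl : IsClosed ((Prod.snd : (ℕ → A) × (ℕ → A) → ℕ → A) ⁻¹' Y) := hY.preimage continuous_snd
    exact (isClosed_setOf_measure_eq_one hcl).mem_of_tendsto hlim (Eventually.of_forall fun n =>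
      empirical_eq_one hcl.measurableSet (fun p hp => hmaps hp) hy n)
  · refine ProbabilityMeasure.toMeasure_injective
      (ext_of_forall_integral_eq_of_IsFiniteMeasure fun f => ?_)
    have h1 := ProbabilityMeasure.tendsto_iff_forall_integral_tendsto.1 hlim
      (f.compContinuous ⟨Prod.fst, continuous_fst⟩)
    have h2 := ((hx f).comp (tendsto_add_atTop_nat 1)).mono_left hU
    have h3 : ∫ z, f z ∂(fstMarginal lam : Measure (ℕ → A)) =
        ∫ p, f p.1 ∂(lam : Measure ((ℕ → A) × (ℕ → A))) :=
      integral_map measurable_fst.aemeasurable f.continuous.aestronglyMeasurable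
    rw [h3]
    refine tendsto_nhds_unique h1 (h2.congr fun n => ?_)
    rw [integral_empirical]
    simp [birkhoffAverage, birkhoffSum, iterate_pairShift]
  · have hev : ∀ᶠ n in (U : Filter ℕ),
        (empirical pairShift (x, y) n : Measure ((ℕ → A) × (ℕ → A))) (zeroNe A) < r := hUr
    exact le_of_tendsto ((continuous_measure_of_isClopen isClopen_zeroNe).tendsto lam |>.comp hlim)
      (hev.mono fun n hn => hn.le)

theorem iSup_ergodicMeasures_le_iSup_dLower {X Y : Set (ℕ → A)} (hX : IsClosed X)
    (hY : IsClosed Y) (hmaps : Set.MapsTo shiftMap Y Y) :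
    ⨆ μ ∈ ergodicMeasures X, ⨅ ν ∈ ergodicMeasures Y, dMeas μ ν ≤ ⨆ x ∈ X, ⨅ y ∈ Y, dLower x y := by
  refine iSup₂_le fun μ hμ => le_of_forall_gt_imp_ge_of_dense fun r hr => ?_
  have hXae : ∀ᵐ x ∂(μ : Measure (ℕ → A)), x ∈ X :=
    (prob_compl_eq_zero_iff hX.measurableSet).2 hμ.1.2
  obtain ⟨x, hxX, hx⟩ := (hXae.and (ae_forall_tendsto_birkhoffAverage hμ.2)).exists
  have hlt := (le_iSup₂ (f := fun x (_ : x ∈ X) => ⨅ y ∈ Y, dLower x y) x hxX).trans_lt hr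
  simp only [iInf_lt_iff] at hlt
  obtain ⟨y, hy, hlt⟩ := hlt
  obtain ⟨lam, hlam, rfl, hcost⟩ := exists_joining_of_dLower_lt hx hY hmaps hy hlt
  obtain ⟨ν, hν, hle⟩ := exists_ergodic_dMeas_le hY hlam hμ.2
  exact (iInf₂_le ν hν).trans (hle.trans hcost)

end PointwiseComparison

end DBar

theorem mainTheorem3 {A : Type*} [Finite A] [TopologicalSpace A] [DiscreteTopology A]
    [MeasurableSpace A] [BorelSpace A] (X Y : Set (ℕ → A))
    (hX : DBar.IsShiftSpace X) (hY : DBar.IsShiftSpace Y) :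
    DBar.hausdorffPremetric DBar.dMeas (DBar.invariantMeasures X) (DBar.invariantMeasures Y) =
        DBar.hausdorffPremetric DBar.dMeas (DBar.ergodicMeasures X) (DBar.ergodicMeasures Y) ∧
      DBar.hausdorffPremetric DBar.dMeas (DBar.ergodicMeasures X) (DBar.ergodicMeasures Y) ≤
        DBar.hausdorffPremetric DBar.dLower X Y ∧
      DBar.hausdorffPremetric DBar.dLower X Y ≤ DBar.hausdorffPremetric DBar.dUpper X Y := by
  obtain ⟨-, hXc, hXm⟩ := (DBar.isShiftSpace_iff X).1 hX
  obtain ⟨-, hYc, hYm⟩ := (DBar.isShiftSpace_iff Y).1 hY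
  refine ⟨le_antisymm ?_ ?_, ?_, ?_⟩
  · exact max_le_max (DBar.iSup_invariantMeasures_le_iSup_ergodicMeasures hXc hYc)
      (DBar.iSup_invariantMeasures_le_iSup_ergodicMeasures hYc hXc)
  · exact max_le_max (DBar.iSup_ergodicMeasures_le_iSup_invariantMeasures X hYc)
      (DBar.iSup_ergodicMeasures_le_iSup_invariantMeasures Y hXc)
  · exact max_le_max (DBar.iSup_ergodicMeasures_le_iSup_dLower hXc hYc hYm)
      (DBar.iSup_ergodicMeasures_le_iSup_dLower hYc hXc hXm)
  · have h : ∀ x y : ℕ → A, DBar.dLower x y ≤ DBar.dUpper x y := fun x y => liminf_le_limsup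
    exact max_le_max (iSup₂_mono fun x _ => iInf₂_mono fun y _ => h x y)
      (iSup₂_mono fun x _ => iInf₂_mono fun y _ => h x y)
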